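/- Let $n,p\ge 0$ be integers and let $M$ be a nonempty compact smooth manifold without boundary of dimension $2n+1$. An \emph{almost cosymplectic structure} on $M$ is a pair $(\eta,\Omega)$ of a smooth $1$-form $\eta$ and a smooth $2$-form $\Omega$ such that $\eta\wedge\Omega^n$ is a volume form (i.e. vanishes nowhere). Let $(\eta_1,\Omega_1),\dots,(\eta_{p+1},\Omega_{p+1})$ be a \emph{cosymplectic $p$-sphere} on $M$, that is, almost cosymplectic structures on $M$ with $d\eta_i=0$ and $d\Omega_i=0$ for all $i$, such that $\bigl(\sum_i\lambda_i\eta_i,\sum_i\lambda_i\Omega_i\bigr)$ is an almost cosymplectic structure for every $\lambda=(\lambda_1,\dots,\lambda_{p+1})\in\mathbb S^p\subset\mathbb R^{p+1}$. Write $H^k(M)$ for the real de Rham cohomology of $M$ and $b_k=\dim_{\mathbb R}H^k(M)$. Then: (i) the classes $[\eta_1],\dots,[\eta_{p+1}]\in H^1(M)$ are nonzero and linearly independent, and therefore $b_1\ge p+1$; (ii) if $(n,p)\ne(0,0)$, the classes $[\Omega_1],\dots,[\Omega_{p+1}]\in H^2(M)$ are nonzero and linearly independent, and therefore $b_2\ge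 p+1$. -/

import Mathlib

open scoped Manifold ContDiff

noncomputable section

namespace CosymplecticSphere

section Forms

variable {E : Type*} [NormedAddCommGroup E] [NormedSpace ℝ E]
  {M : Type*} [TopologicalSpace M] [ChartedSpace E M]

/-- A (not necessarily smooth) real differential `k`-form on `M`. -/
abbrev RawForm (E : Type*) [NormedAddCommGroup E] [NormedSpace ℝ E]
    (M : Type*) [TopologicalSpace M] [ChartedSpace E M] (k : ℕ) : Type _ :=
  (x : M) → (TangentSpace 𝓘(ℝ, E) x) [⋀^Fin k]→L[ℝ] ℝ

/-- The pullback of a form to the model space by the inverse of a chart `e`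
(meaningful on `e.target`). -/
def inChart {k : ℕ} (α : RawForm E M k) (e : OpenPartialHomeomorph M E) (y : E) :
    E [⋀^Fin k]→L[ℝ] ℝ :=
  ContinuousAlternatingMap.compContinuousLinearMap (M := E) (α (e.symm y))
    (mfderiv 𝓘(ℝ, E) 𝓘(ℝ, E) e.symm y)

/-- The exterior derivative, computed at `x` in the preferred chart at `x`. -/
def rawD {k : ℕ} (α : RawForm E M k) : RawForm E M (k + 1) := fun x =>
  ContinuousAlternatingMap.compContinuousLinearMap (M' := E)
    (extDeriv (inChart α (chartAt E x)) (chartAt E x x))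
    (mfderiv 𝓘(ℝ, E) 𝓘(ℝ, E) (chartAt E x) x)

/-- Smooth differential `k`-forms on `M`: forms whose expression in every smooth chart is smooth. -/
def DiffForm (E : Type*) [NormedAddCommGroup E] [NormedSpace ℝ E]
    (M : Type*) [TopologicalSpace M] [ChartedSpace E M] (k : ℕ) :
    Submodule ℝ (RawForm E M k) where
  carrier := {α | ∀ e ∈ IsManifold.maximalAtlas 𝓘(ℝ, E) ∞ M,
    ContDiffOn ℝ ∞ (inChart α e) e.target}
  add_mem' := fun ha hb e he => (ha e he).add (hb e he)
  zero_mem' := fun _ _ => contDiffOn_const (c := 0)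
  smul_mem' := fun c _ ha e he => (ha e he).const_smul c

instance instAddCommGroupDiffForm (k : ℕ) : AddCommGroup (DiffForm E M k) :=
  Submodule.addCommGroup _

theorem mdifferentiableAt_chart {e : OpenPartialHomeomorph M E}
    (he : e ∈ IsManifold.maximalAtlas 𝓘(ℝ, E) ∞ M) {x : M} (hx : x ∈ e.source) :
    MDifferentiableAt 𝓘(ℝ, E) 𝓘(ℝ, E) e x :=
  ((contMDiffOn_of_mem_maximalAtlas he).contMDiffAt (e.open_source.mem_nhds hx)).mdifferentiableAt
    (by simp)

theorem mdifferentiableAt_chart_symm {e : OpenPartialHomeomorph M E}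
    (he : e ∈ IsManifold.maximalAtlas 𝓘(ℝ, E) ∞ M) {y : E} (hy : y ∈ e.target) :
    MDifferentiableAt 𝓘(ℝ, E) 𝓘(ℝ, E) e.symm y :=
  ((contMDiffOn_symm_of_mem_maximalAtlas he).contMDiffAt
    (e.open_target.mem_nhds hy)).mdifferentiableAt (by simp)

theorem fderiv_transition {e e' : OpenPartialHomeomorph M E}
    (he : e ∈ IsManifold.maximalAtlas 𝓘(ℝ, E) ∞ M)
    (he' : e' ∈ IsManifold.maximalAtlas 𝓘(ℝ, E) ∞ M)
    {y : E} (hy : y ∈ e.target) (hy' : e.symm y ∈ e'.source) (v : E) :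
    fderiv ℝ (e' ∘ e.symm) y v =
      mfderiv 𝓘(ℝ, E) 𝓘(ℝ, E) e' (e.symm y) (mfderiv 𝓘(ℝ, E) 𝓘(ℝ, E) e.symm y v) := by
  have h := mfderiv_comp y (mdifferentiableAt_chart he' hy') (mdifferentiableAt_chart_symm he hy)
  rw [mfderiv_eq_fderiv] at h
  exact DFunLike.congr_fun h v

theorem mfderiv_chart_symm_chart {e : OpenPartialHomeomorph M E}
    (he : e ∈ IsManifold.maximalAtlas 𝓘(ℝ, E) ∞ M) {x : M} (hx : x ∈ e.source)
    (v : TangentSpace 𝓘(ℝ, E) x) :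
    mfderiv 𝓘(ℝ, E) 𝓘(ℝ, E) e.symm (e x) (mfderiv 𝓘(ℝ, E) 𝓘(ℝ, E) e x v) = v := by
  have h := mfderiv_comp x
    (mdifferentiableAt_chart_symm he (e.map_source hx)) (mdifferentiableAt_chart he hx)
  have h2 : mfderiv 𝓘(ℝ, E) 𝓘(ℝ, E) (e.symm ∘ e) x = mfderiv 𝓘(ℝ, E) 𝓘(ℝ, E) (id : M → M) x := by
    apply Filter.EventuallyEq.mfderiv_eq
    filter_upwards [e.open_source.mem_nhds hx] with z hz
    simp [e.left_inv hz]
  have h3 := DFunLike.congr_fun (h.symm.trans h2) v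
  rw [mfderiv_id] at h3
  exact h3

theorem inChart_change {k : ℕ} (α : RawForm E M k) {e e' : OpenPartialHomeomorph M E}
    (he : e ∈ IsManifold.maximalAtlas 𝓘(ℝ, E) ∞ M)
    (he' : e' ∈ IsManifold.maximalAtlas 𝓘(ℝ, E) ∞ M)
    {y : E} (hy : y ∈ e.target) (hy' : e.symm y ∈ e'.source) :
    inChart α e y = (inChart α e' ((e' ∘ e.symm) y)).compContinuousLinearMap
      (fderiv ℝ (e' ∘ e.symm) y) := by
  have hx : e'.symm (e' (e.symm y)) = e.symm y := e'.left_inv hy'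
  have hα : ∀ x x' : M, x = x' →
      (α x : E [⋀^Fin k]→L[ℝ] ℝ) = (α x' : E [⋀^Fin k]→L[ℝ] ℝ) := by
    rintro x _ rfl
    rfl
  have key : ∀ w : E, (mfderiv 𝓘(ℝ, E) 𝓘(ℝ, E) e'.symm (e' (e.symm y))
      (fderiv ℝ (e' ∘ e.symm) y w) : E) = mfderiv 𝓘(ℝ, E) 𝓘(ℝ, E) e.symm y w := by
    intro w
    rw [fderiv_transition he he' hy hy']
    exact mfderiv_chart_symm_chart he' hy' _
  ext v
  refine (congrArg (fun f : E [⋀^Fin k]→L[ℝ] ℝ =>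
    f fun i => mfderiv 𝓘(ℝ, E) 𝓘(ℝ, E) e.symm y (v i)) (hα _ _ hx.symm)).trans ?_
  exact congrArg (α (e'.symm (e' (e.symm y))) : E [⋀^Fin k]→L[ℝ] ℝ)
    (funext fun i => (key (v i)).symm)

theorem contDiffAt_transition {e e' : OpenPartialHomeomorph M E}
    (he : e ∈ IsManifold.maximalAtlas 𝓘(ℝ, E) ∞ M)
    (he' : e' ∈ IsManifold.maximalAtlas 𝓘(ℝ, E) ∞ M)
    {y : E} (hy : y ∈ e.target) (hy' : e.symm y ∈ e'.source) :
    ContDiffAt ℝ ∞ (e' ∘ e.symm) y :=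
  (((contMDiffOn_of_mem_maximalAtlas he').contMDiffAt (e'.open_source.mem_nhds hy')).comp y
    ((contMDiffOn_symm_of_mem_maximalAtlas he).contMDiffAt
      (e.open_target.mem_nhds hy))).contDiffAt

/-- In every smooth chart, `rawD` is the exterior derivative of the model space. -/
theorem inChart_rawD [IsManifold 𝓘(ℝ, E) ∞ M] {k : ℕ} {α : RawForm E M k}
    (hα : α ∈ DiffForm E M k) {e : OpenPartialHomeomorph M E}
    (he : e ∈ IsManifold.maximalAtlas 𝓘(ℝ, E) ∞ M) {y : E} (hy : y ∈ e.target) :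
    inChart (rawD α) e y = extDeriv (inChart α e) y := by
  set e' := chartAt E (e.symm y) with he'_def
  have he' : e' ∈ IsManifold.maximalAtlas 𝓘(ℝ, E) ∞ M := IsManifold.chart_mem_maximalAtlas _
  have hy' : e.symm y ∈ e'.source := mem_chart_source E _
  have hev : inChart α e =ᶠ[nhds y] fun z => (inChart α e' ((e' ∘ e.symm) z)).compContinuousLinearMap
      (fderiv ℝ (e' ∘ e.symm) z) := by
    filter_upwards [e.open_target.mem_nhds hy,
      (e.continuousAt_symm hy).preimage_mem_nhds (e'.open_source.mem_nhds hy')] with z hz hz'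
    exact inChart_change α he he' hz hz'
  rw [hev.extDeriv_eq, extDeriv_pullback (r := ∞) _ (contDiffAt_transition he he' hy hy')
    (by simpa using WithTop.coe_le_coe.2 (le_top (a := (2 : ℕ∞))))]
  · ext v
    exact congrArg (extDeriv (inChart α e') (e' (e.symm y)))
      (funext fun i => (fderiv_transition he he' hy hy' (v i)).symm)
  · exact ((hα e' he').contDiffAt
      (e'.open_target.mem_nhds (e'.map_source hy'))).differentiableAt (by simp)

theorem rawD_mem [IsManifold 𝓘(ℝ, E) ∞ M] {k : ℕ} {α : RawForm E M k}
    (hα : α ∈ DiffForm E M k) : rawD α ∈ DiffForm E M (k + 1) := by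
  intro e he
  have h : ContDiffOn ℝ ∞ (extDeriv (inChart α e)) e.target :=
    (ContinuousAlternatingMap.alternatizeUncurryFinCLM ℝ E ℝ).contDiff.comp_contDiffOn
      ((hα e he).fderiv_of_isOpen e.open_target (by simp))
  exact h.congr fun y hy => inChart_rawD hα he hy

theorem differentiableAt_inChart [IsManifold 𝓘(ℝ, E) ∞ M] {k : ℕ} {α : RawForm E M k}
    (hα : α ∈ DiffForm E M k) (x : M) :
    DifferentiableAt ℝ (inChart α (chartAt E x)) (chartAt E x x) :=
  ((hα _ (IsManifold.chart_mem_maximalAtlas x)).contDiffAt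
    ((chartAt E x).open_target.mem_nhds (mem_chart_target E x))).differentiableAt (by simp)

/-- The exterior derivative on smooth forms. -/
def d (E : Type*) [NormedAddCommGroup E] [NormedSpace ℝ E]
    (M : Type*) [TopologicalSpace M] [ChartedSpace E M] [IsManifold 𝓘(ℝ, E) ∞ M] (k : ℕ) :
    DiffForm E M k →ₗ[ℝ] DiffForm E M (k + 1) where
  toFun α := ⟨rawD α.1, rawD_mem α.2⟩
  map_add' α β := by
    ext x v
    have h := extDeriv_add (differentiableAt_inChart α.2 x) (differentiableAt_inChart β.2 x)
    exact congrArg (fun f : E [⋀^Fin (k + 1)]→L[ℝ] ℝ =>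
      f fun i => mfderiv 𝓘(ℝ, E) 𝓘(ℝ, E) (chartAt E x) x (v i)) h
  map_smul' c α := by
    ext x v
    have h := extDeriv_smul (x := chartAt E x x) c (inChart α.1 (chartAt E x))
    exact congrArg (fun f : E [⋀^Fin (k + 1)]→L[ℝ] ℝ =>
      f fun i => mfderiv 𝓘(ℝ, E) 𝓘(ℝ, E) (chartAt E x) x (v i)) h

section Cohomology

variable (E : Type*) [NormedAddCommGroup E] [NormedSpace ℝ E]
  (M : Type*) [TopologicalSpace M] [ChartedSpace E M] [IsManifold 𝓘(ℝ, E) ∞ M]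

/-- The closed smooth `k`-forms. -/
def closedForms (k : ℕ) : Submodule ℝ (DiffForm E M k) := LinearMap.ker (d E M k)

/-- The exact smooth `k`-forms; only `0` is exact in degree `0`. -/
def exactForms : (k : ℕ) → Submodule ℝ (DiffForm E M k)
  | 0 => ⊥
  | k + 1 => LinearMap.range (d E M k)

/-- The real de Rham cohomology `H^k(M)`, closed forms modulo exact forms. -/
abbrev DeRham (k : ℕ) : Type _ :=
  closedForms E M k ⧸ (exactForms E M k).submoduleOf (closedForms E M k)

/-- The Betti number `b_k`, the dimension of `H^k(M)`. -/
def betti (k : ℕ) : Cardinal := Module.rank ℝ (DeRham E M k)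

end Cohomology

/-- The cohomology class of a closed form. -/
def deRhamClass [IsManifold 𝓘(ℝ, E) ∞ M] {k : ℕ} (α : DiffForm E M k)
    (hα : α ∈ closedForms E M k) : DeRham E M k :=
  Submodule.Quotient.mk ⟨α, hα⟩

end Forms

section Wedge

variable {V : Type*} [AddCommGroup V] [Module ℝ V]

/-- The wedge product of real-valued alternating maps (sum over shuffles). -/
def wedge {k l : ℕ} (a : V [⋀^Fin k]→ₗ[ℝ] ℝ) (b : V [⋀^Fin l]→ₗ[ℝ] ℝ) :
    V [⋀^Fin (k + l)]→ₗ[ℝ] ℝ :=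
  ((LinearMap.mul' ℝ ℝ).compAlternatingMap (a.domCoprod b)).domDomCongr finSumFinEquiv

/-- The exterior power `b ∧ ⋯ ∧ b` (`n` factors) of an alternating 2-form. -/
def wedgePow (b : V [⋀^Fin 2]→ₗ[ℝ] ℝ) : (n : ℕ) → V [⋀^Fin (2 * n)]→ₗ[ℝ] ℝ
  | 0 => AlternatingMap.constOfIsEmpty ℝ V (Fin 0) 1
  | n + 1 => wedge (wedgePow b n) b

end Wedge

section Cosymplectic

variable {n : ℕ} {M : Type*} [TopologicalSpace M]
  [ChartedSpace (EuclideanSpace ℝ (Fin (2 * n + 1))) M]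

/-- `(η, Ω)` is an almost cosymplectic structure on the `(2n+1)`-manifold `M`:
the top degree form `η ∧ Ω^n` vanishes nowhere. -/
def IsAlmostCosymplectic (η : DiffForm (EuclideanSpace ℝ (Fin (2 * n + 1))) M 1)
    (Ω : DiffForm (EuclideanSpace ℝ (Fin (2 * n + 1))) M 2) : Prop :=
  ∀ x : M, wedge (η.1 x).toAlternatingMap (wedgePow (Ω.1 x).toAlternatingMap n) ≠ 0

/-- The pairs `(η i, Ω i)` generate an almost cosymplectic `p`-sphere. -/
structure IsAlmostCosymplecticSphere {p : ℕ}
    (η : Fin (p + 1) → DiffForm (EuclideanSpace ℝ (Fin (2 * n + 1))) M 1)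
    (Ω : Fin (p + 1) → DiffForm (EuclideanSpace ℝ (Fin (2 * n + 1))) M 2) : Prop where
  generators : ∀ i, IsAlmostCosymplectic (η i) (Ω i)
  sphere : ∀ c ∈ Metric.sphere (0 : EuclideanSpace ℝ (Fin (p + 1))) 1,
    IsAlmostCosymplectic (∑ i, c i • η i) (∑ i, c i • Ω i)

/-- The pairs `(η i, Ω i)` generate a cosymplectic `p`-sphere: they generate an almost cosymplectic
`p`-sphere and all the forms are closed. -/
structure IsCosymplecticSphere [IsManifold (𝓡 (2 * n + 1)) ∞ M] {p : ℕ}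
    (η : Fin (p + 1) → DiffForm (EuclideanSpace ℝ (Fin (2 * n + 1))) M 1)
    (Ω : Fin (p + 1) → DiffForm (EuclideanSpace ℝ (Fin (2 * n + 1))) M 2) : Prop extends
    IsAlmostCosymplecticSphere η Ω where
  closed_eta : ∀ i, η i ∈ closedForms (EuclideanSpace ℝ (Fin (2 * n + 1))) M 1
  closed_omega : ∀ i, Ω i ∈ closedForms (EuclideanSpace ℝ (Fin (2 * n + 1))) M 2

end Cosymplectic

end CosymplecticSphere

end

/-!
By Stokes' theorem the integral of an exact top degree form over a closed oriented manifold is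
zero, so the exact form has a zero. For a closed almost cosymplectic pair `(η, Ω)` this excludes
`η = df`, since then `η ∧ Ωⁿ = d(f Ωⁿ)`, and, for `n > 0`, it excludes `Ω = dα`, since then
`η ∧ Ωⁿ = -d(η ∧ Ωⁿ⁻¹ ∧ α)`. On a cosymplectic sphere both facts apply to the linear combinations
with coefficients in the unit sphere, hence no nontrivial combination of the classes vanishes.
If `p > 0` then `n > 0`: the `p + 1` forms `ηᵢ` are linearly independent at every point, so
`p + 1 ≤ 2n + 1`. Stokes' theorem is proved with a partition of unity, integrating in charts; as
an exact form without zeros is what has to be excluded, that form itself orients the manifold.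
-/

noncomputable section

namespace CosymplecticSphere

section Alternatization

open Equiv.Perm (decomposeFin)

variable {R V N : Type*} [CommRing R] [AddCommGroup V] [Module R V] [AddCommGroup N] [Module R N]

theorem alternatization_domDomCongr {ι κ : Type*} [Fintype ι] [DecidableEq ι] [Fintype κ]
    [DecidableEq κ] (e : ι ≃ κ) (f : MultilinearMap R (fun _ : ι => V) N) :
    (f.domDomCongr e).alternatization = f.alternatization.domDomCongr e := by
  ext v
  simp only [MultilinearMap.alternatization_apply, AlternatingMap.domDomCongr_apply,
    MultilinearMap.domDomCongr_apply]
  refine (Fintype.sum_equiv e.permCongr _ _ fun σ => ?_).symm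
  simp [Equiv.Perm.sign_permCongr]

theorem bijective_cycleRange_symm_mul_decomposeFin_symm (m : ℕ) :
    Function.Bijective fun q : Fin (m + 1) × Equiv.Perm (Fin m) =>
      (q.1.cycleRange.symm * decomposeFin.symm (0, q.2) : Equiv.Perm (Fin (m + 1))) := by
  refine (Fintype.bijective_iff_injective_and_card _).2 ⟨?_, ?_⟩
  · rintro ⟨p, σ⟩ ⟨p', σ'⟩ h
    obtain rfl : p = p' := by simpa using DFunLike.congr_fun h 0
    simpa using h
  · simp [Fintype.card_perm, Nat.factorial_succ]

/-- A linear map into multilinear maps, read as a multilinear map in one more variable: the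
non-dependent form of `LinearMap.uncurryLeft`. -/
abbrev uncurryZero {m : ℕ} (c : V →ₗ[R] MultilinearMap R (fun _ : Fin m => V) N) :
    MultilinearMap R (fun _ : Fin (m + 1) => V) N :=
  LinearMap.uncurryLeft (M := fun _ => V) c

-- Each permutation of `Fin (m + 1)` is uniquely a choice of the image of `0` followed by a
-- permutation of the rest, which splits the alternating sum on the right.
theorem alternatizeUncurryFin_eq_alternatization_uncurryZero {m : ℕ}
    {c : V →ₗ[R] MultilinearMap R (fun _ : Fin m => V) N} {A : V →ₗ[R] V [⋀^Fin m]→ₗ[R] N}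
    (hA : ∀ x, A x = (c x).alternatization) :
    AlternatingMap.alternatizeUncurryFin A = (uncurryZero c).alternatization := by
  ext v
  rw [AlternatingMap.alternatizeUncurryFin_apply, MultilinearMap.alternatization_apply,
    ← (bijective_cycleRange_symm_mul_decomposeFin_symm m).sum_comp, Fintype.sum_prod_type]
  refine Finset.sum_congr rfl fun p _ => ?_
  rw [hA, MultilinearMap.alternatization_apply, Finset.smul_sum]
  refine Finset.sum_congr rfl fun σ _ => ?_
  simp [Units.smul_def, mul_smul, Fin.removeNth, Fin.tail_def]

end Alternatization

section TensorForm

variable {R V : Type*} [CommRing R] [AddCommGroup V] [Module R V]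

/-- The tensor product of two multilinear forms, with concatenated arguments, as a bilinear
operation. -/
def tensorForm (k l : ℕ) : MultilinearMap R (fun _ : Fin k => V) R →ₗ[R]
    MultilinearMap R (fun _ : Fin l => V) R →ₗ[R] MultilinearMap R (fun _ : Fin (k + l) => V) R :=
  LinearMap.mk₂ R
    (fun a b =>
      ((LinearMap.mul' R R).compMultilinearMap (a.domCoprod b)).domDomCongr finSumFinEquiv)
    (fun a a' b => by ext v; simp [add_mul])
    (fun c a b => by ext v; simp [mul_assoc])
    (fun a b b' => by ext v; simp [mul_add])
    (fun c a b => by ext v; simp [mul_left_comm])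

theorem tensorForm_apply {k l : ℕ} (a : MultilinearMap R (fun _ : Fin k => V) R)
    (b : MultilinearMap R (fun _ : Fin l => V) R) (v : Fin (k + l) → V) :
    tensorForm k l a b v =
      a (fun i => v (Fin.castAdd l i)) * b (fun j => v (Fin.natAdd k j)) := by
  simp [tensorForm]

theorem uncurryZero_tensorForm_left {k l : ℕ}
    (c : V →ₗ[R] MultilinearMap R (fun _ : Fin k => V) R)
    (b : MultilinearMap R (fun _ : Fin l => V) R) :
    uncurryZero ((tensorForm k l).flip b ∘ₗ c) =
      (tensorForm (k + 1) l (uncurryZero c) b).domDomCongr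
        (finCongr (Nat.add_right_comm k 1 l)) := by
  ext v
  have hr : ∀ j : Fin l, Fin.cast (Nat.add_right_comm k 1 l) (Fin.natAdd (k + 1) j) =
      (Fin.natAdd k j).succ := fun j => Fin.ext (by simp; omega)
  simp only [LinearMap.uncurryLeft_apply, LinearMap.comp_apply, LinearMap.flip_apply,
    tensorForm_apply, MultilinearMap.domDomCongr_apply]
  exact congrArg₂ (· * ·) rfl (congrArg b (funext fun j => congrArg v (hr j).symm))

theorem uncurryZero_tensorForm_right {k l : ℕ}
    (a : MultilinearMap R (fun _ : Fin k => V) R)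
    (c : V →ₗ[R] MultilinearMap R (fun _ : Fin l => V) R) :
    uncurryZero (tensorForm k l a ∘ₗ c) =
      (tensorForm k (l + 1) a (uncurryZero c)).domDomCongr (Fin.cycleRange (Fin.natAdd k 0)) := by
  ext v
  have hl : ∀ i : Fin k, Fin.cycleRange (Fin.natAdd k 0) (Fin.castAdd (l + 1) i) =
      (Fin.castAdd l i).succ := fun i =>
    Fin.ext (by rw [Fin.coe_cycleRange_of_lt (by simp [Fin.lt_def])]; simp)
  have hr : ∀ j : Fin l, Fin.cycleRange (Fin.natAdd k 0) (Fin.natAdd k j.succ) =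
      (Fin.natAdd k j).succ := fun j =>
    (Fin.cycleRange_of_gt (by simp [Fin.lt_def])).trans (Fin.ext (by simp [add_assoc]))
  have h0 : Fin.cycleRange (Fin.natAdd k (0 : Fin (l + 1))) (Fin.natAdd k 0) =
    (0 : Fin (k + l + 1)) := Fin.cycleRange_self _
  simp only [LinearMap.uncurryLeft_apply, LinearMap.comp_apply,
    tensorForm_apply, MultilinearMap.domDomCongr_apply]
  refine congrArg₂ (· * ·) (congrArg a (funext fun i => congrArg v (hl i).symm)) ?_
  exact congrArg₂ (fun x w => c x w) (congrArg v h0.symm) (funext fun j => congrArg v (hr j).symm)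

end TensorForm

section WedgeAlgebra

variable {V : Type*} [AddCommGroup V] [Module ℝ V] {k l : ℕ}

/-- A linear section of alternatization: an alternating map is the alternatization of its `k!`-th
part. -/
def alternatizationSection (k : ℕ) :
    V [⋀^Fin k]→ₗ[ℝ] ℝ →ₗ[ℝ] MultilinearMap ℝ (fun _ : Fin k => V) ℝ :=
  (k.factorial : ℝ)⁻¹ • AlternatingMap.toMultilinearMapLM

theorem alternatization_alternatizationSection (a : V [⋀^Fin k]→ₗ[ℝ] ℝ) :
    (alternatizationSection k a).alternatization = a := by
  ext v
  have h := DFunLike.congr_fun a.coe_alternatization v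
  simp only [MultilinearMap.alternatization_apply, AlternatingMap.smul_apply, Fintype.card_fin,
    MultilinearMap.domDomCongr_apply, AlternatingMap.coe_multilinearMap, nsmul_eq_mul] at h
  simp [MultilinearMap.alternatization_apply, alternatizationSection, ← mul_smul_comm,
    ← Finset.mul_sum, h, k.factorial_ne_zero]

theorem wedge_alternatization (a : MultilinearMap ℝ (fun _ : Fin k => V) ℝ)
    (b : MultilinearMap ℝ (fun _ : Fin l => V) ℝ) :
    wedge a.alternatization b.alternatization = (tensorForm k l a b).alternatization := by
  simp only [tensorForm, LinearMap.mk₂_apply]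
  rw [alternatization_domDomCongr, LinearMap.compMultilinearMap_alternatization,
    MultilinearMap.domCoprod_alternization]
  rfl

theorem wedge_eq_alternatization (a : V [⋀^Fin k]→ₗ[ℝ] ℝ) (b : V [⋀^Fin l]→ₗ[ℝ] ℝ) :
    wedge a b = (tensorForm k l (alternatizationSection k a)
      (alternatizationSection l b)).alternatization := by
  rw [← wedge_alternatization, alternatization_alternatizationSection,
    alternatization_alternatizationSection]

theorem wedge_apply (a : V [⋀^Fin k]→ₗ[ℝ] ℝ) (b : V [⋀^Fin l]→ₗ[ℝ] ℝ) (v : Fin (k + l) → V) :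
    wedge a b v = (k.factorial * l.factorial : ℝ)⁻¹ *
      ∑ σ : Equiv.Perm (Fin (k + l)), Equiv.Perm.sign σ •
        (a (fun i => v (σ (Fin.castAdd l i))) * b (fun j => v (σ (Fin.natAdd k j)))) := by
  simp [wedge_eq_alternatization, MultilinearMap.alternatization_apply, tensorForm_apply,
    alternatizationSection, Finset.mul_sum, mul_smul_comm, mul_assoc, mul_left_comm]

/-- The wedge product as a bilinear map. -/
def wedgeLin (k l : ℕ) : (V [⋀^Fin k]→ₗ[ℝ] ℝ) →ₗ[ℝ] (V [⋀^Fin l]→ₗ[ℝ] ℝ) →ₗ[ℝ]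
    (V [⋀^Fin (k + l)]→ₗ[ℝ] ℝ) :=
  LinearMap.mk₂ ℝ wedge
    (fun a a' b => by ext v; simp [wedge_apply, add_mul, Finset.sum_add_distrib, mul_add])
    (fun c a b => by
      ext v
      simp [wedge_apply, mul_smul_comm, Finset.mul_sum, mul_assoc, mul_left_comm c])
    (fun a b b' => by ext v; simp [wedge_apply, mul_add, Finset.sum_add_distrib])
    (fun c a b => by ext v; simp [wedge_apply, mul_smul_comm, Finset.mul_sum, mul_left_comm c])

theorem alternatizeUncurryFin_wedge_left (A : V →ₗ[ℝ] V [⋀^Fin k]→ₗ[ℝ] ℝ)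
    (b : V [⋀^Fin l]→ₗ[ℝ] ℝ) :
    AlternatingMap.alternatizeUncurryFin ((wedgeLin k l).flip b ∘ₗ A) =
      (wedge (AlternatingMap.alternatizeUncurryFin A) b).domDomCongr
        (finCongr (Nat.add_right_comm k 1 l)) := by
  have hA : ∀ x, ((alternatizationSection k ∘ₗ A) x).alternatization = A x := fun x =>
    alternatization_alternatizationSection (A x)
  rw [alternatizeUncurryFin_eq_alternatization_uncurryZero
    (fun x => wedge_eq_alternatization (A x) b)
    (c := (tensorForm k l).flip (alternatizationSection l b) ∘ₗ alternatizationSection k ∘ₗ A),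
    alternatizeUncurryFin_eq_alternatization_uncurryZero fun x => (hA x).symm,
    uncurryZero_tensorForm_left, alternatization_domDomCongr, ← wedge_alternatization,
    alternatization_alternatizationSection]

theorem alternatizeUncurryFin_wedge_right (a : V [⋀^Fin k]→ₗ[ℝ] ℝ)
    (B : V →ₗ[ℝ] V [⋀^Fin l]→ₗ[ℝ] ℝ) :
    AlternatingMap.alternatizeUncurryFin (wedgeLin k l a ∘ₗ B) =
      (-1 : ℝ) ^ k • wedge a (AlternatingMap.alternatizeUncurryFin B) := by
  have hB : ∀ x, ((alternatizationSection l ∘ₗ B) x).alternatization = B x := fun x =>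
    alternatization_alternatizationSection (B x)
  rw [alternatizeUncurryFin_eq_alternatization_uncurryZero
    (fun x => wedge_eq_alternatization a (B x))
    (c := tensorForm k l (alternatizationSection k a) ∘ₗ alternatizationSection l ∘ₗ B),
    alternatizeUncurryFin_eq_alternatization_uncurryZero fun x => (hB x).symm,
    uncurryZero_tensorForm_right, alternatization_domDomCongr, AlternatingMap.domDomCongr_perm,
    ← wedge_alternatization, alternatization_alternatizationSection, Fin.sign_cycleRange]
  simp [Units.smul_def, ← Int.cast_smul_eq_zsmul ℝ]

end WedgeAlgebra

section ContinuousWedge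

variable {E F : Type*} [NormedAddCommGroup E] [NormedSpace ℝ E] [NormedAddCommGroup F]
  [NormedSpace ℝ F] {k l : ℕ}

theorem norm_wedge_apply_le (a : E [⋀^Fin k]→L[ℝ] ℝ) (b : E [⋀^Fin l]→L[ℝ] ℝ)
    (v : Fin (k + l) → E) :
    ‖wedge a.toAlternatingMap b.toAlternatingMap v‖ ≤
      (k.factorial * l.factorial : ℝ)⁻¹ * (k + l).factorial * ‖a‖ * ‖b‖ * ∏ i, ‖v i‖ := by
  have hterm : ∀ σ : Equiv.Perm (Fin (k + l)), ‖Equiv.Perm.sign σ •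
      (a (fun i => v (σ (Fin.castAdd l i))) * b (fun j => v (σ (Fin.natAdd k j))))‖ ≤
      ‖a‖ * ‖b‖ * ∏ i, ‖v i‖ := by
    intro σ
    have hprod : (∏ i, ‖v i‖) =
        (∏ i, ‖v (σ (Fin.castAdd l i))‖) * ∏ j, ‖v (σ (Fin.natAdd k j))‖ := by
      rw [← Equiv.prod_comp σ, Fin.prod_univ_add]
    calc ‖Equiv.Perm.sign σ • (_ : ℝ)‖ = ‖a _‖ * ‖b _‖ := by
          rcases Int.units_eq_one_or (Equiv.Perm.sign σ) with h | h <;> simp [h]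
      _ ≤ (‖a‖ * ∏ i, ‖v (σ (Fin.castAdd l i))‖) * (‖b‖ * ∏ j, ‖v (σ (Fin.natAdd k j))‖) :=
          mul_le_mul (a.le_opNorm _) (b.le_opNorm _) (norm_nonneg _) (by positivity)
      _ = ‖a‖ * ‖b‖ * ∏ i, ‖v i‖ := by rw [hprod]; ring
  rw [wedge_apply, norm_mul, Real.norm_of_nonneg (by positivity)]
  calc _ ≤ (k.factorial * l.factorial : ℝ)⁻¹ *
        ∑ _σ : Equiv.Perm (Fin (k + l)), ‖a‖ * ‖b‖ * ∏ i, ‖v i‖ := by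
          gcongr
          exact norm_sum_le_of_le _ fun σ _ => hterm σ
    _ = _ := by
          rw [Finset.sum_const, Finset.card_univ, Fintype.card_perm, Fintype.card_fin,
            nsmul_eq_mul]
          ring

/-- The wedge product of continuous alternating forms. -/
def wedgeC (a : E [⋀^Fin k]→L[ℝ] ℝ) (b : E [⋀^Fin l]→L[ℝ] ℝ) : E [⋀^Fin (k + l)]→L[ℝ] ℝ :=
  (wedge a.toAlternatingMap b.toAlternatingMap).mkContinuous
    ((k.factorial * l.factorial : ℝ)⁻¹ * (k + l).factorial * ‖a‖ * ‖b‖) (norm_wedge_apply_le a b)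

theorem wedgeC_compContinuousLinearMap (a : E [⋀^Fin k]→L[ℝ] ℝ) (b : E [⋀^Fin l]→L[ℝ] ℝ)
    (f : F →L[ℝ] E) :
    (wedgeC a b).compContinuousLinearMap f =
      wedgeC (a.compContinuousLinearMap f) (b.compContinuousLinearMap f) := by
  ext v
  change wedge _ _ (f ∘ v) = wedge _ _ v
  rw [wedge_apply, wedge_apply]
  rfl

/-- The wedge product as a continuous bilinear map. -/
def wedgeCLM (k l : ℕ) : (E [⋀^Fin k]→L[ℝ] ℝ) →L[ℝ] (E [⋀^Fin l]→L[ℝ] ℝ) →L[ℝ]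
    (E [⋀^Fin (k + l)]→L[ℝ] ℝ) :=
  LinearMap.mkContinuous₂
    (LinearMap.mk₂ ℝ wedgeC
      (fun a a' b => ContinuousAlternatingMap.toAlternatingMap_injective
        (LinearMap.map_add₂ (wedgeLin k l) a.toAlternatingMap a'.toAlternatingMap
          b.toAlternatingMap))
      (fun c a b => ContinuousAlternatingMap.toAlternatingMap_injective
        (LinearMap.map_smul₂ (wedgeLin k l) c a.toAlternatingMap b.toAlternatingMap))
      (fun a b b' => ContinuousAlternatingMap.toAlternatingMap_injective
        (map_add (wedgeLin k l a.toAlternatingMap) b.toAlternatingMap b'.toAlternatingMap))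
      (fun c a b => ContinuousAlternatingMap.toAlternatingMap_injective
        (map_smul (wedgeLin k l a.toAlternatingMap) c b.toAlternatingMap)))
    ((k.factorial * l.factorial : ℝ)⁻¹ * (k + l).factorial)
    fun a b => (wedge a.toAlternatingMap b.toAlternatingMap).mkContinuous_norm_le (by positivity)
      (norm_wedge_apply_le a b)

@[simp]
theorem wedgeCLM_apply (a : E [⋀^Fin k]→L[ℝ] ℝ) (b : E [⋀^Fin l]→L[ℝ] ℝ) :
    wedgeCLM k l a b = wedgeC a b := rfl

theorem alternatizeUncurryFin_wedgeC_left_apply (A : E →L[ℝ] E [⋀^Fin k]→L[ℝ] ℝ)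
    (b : E [⋀^Fin l]→L[ℝ] ℝ) (v : Fin (k + l + 1) → E) :
    ContinuousAlternatingMap.alternatizeUncurryFin ((wedgeCLM k l).flip b ∘L A) v =
      wedgeC (ContinuousAlternatingMap.alternatizeUncurryFin A) b
        (v ∘ Fin.cast (Nat.add_right_comm k 1 l)) := by
  have h := DFunLike.congr_fun (alternatizeUncurryFin_wedge_left
    (ContinuousAlternatingMap.toAlternatingMapLinear (R := ℝ) ∘ₗ A.toLinearMap)
      b.toAlternatingMap) v
  rw [← ContinuousAlternatingMap.toAlternatingMap_alternatizeUncurryFin] at h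
  rw [← ContinuousAlternatingMap.coe_toAlternatingMap,
    ContinuousAlternatingMap.toAlternatingMap_alternatizeUncurryFin]
  exact h

theorem alternatizeUncurryFin_wedgeC_right (a : E [⋀^Fin k]→L[ℝ] ℝ)
    (B : E →L[ℝ] E [⋀^Fin l]→L[ℝ] ℝ) :
    ContinuousAlternatingMap.alternatizeUncurryFin (wedgeCLM k l a ∘L B) =
      (-1 : ℝ) ^ k • wedgeC a (ContinuousAlternatingMap.alternatizeUncurryFin B) := by
  have h := alternatizeUncurryFin_wedge_right a.toAlternatingMap
    (ContinuousAlternatingMap.toAlternatingMapLinear (R := ℝ) ∘ₗ B.toLinearMap)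
  rw [← ContinuousAlternatingMap.toAlternatingMap_alternatizeUncurryFin] at h
  apply ContinuousAlternatingMap.toAlternatingMap_injective
  rw [ContinuousAlternatingMap.toAlternatingMap_alternatizeUncurryFin]
  exact h

theorem contDiffOn_wedgeC {r : WithTop ℕ∞} {a : F → E [⋀^Fin k]→L[ℝ] ℝ}
    {b : F → E [⋀^Fin l]→L[ℝ] ℝ} {s : Set F} (ha : ContDiffOn ℝ r a s) (hb : ContDiffOn ℝ r b s) :
    ContDiffOn ℝ r (fun y => wedgeC (a y) (b y)) s := by
  simp only [← wedgeCLM_apply]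
  fun_prop

theorem extDeriv_wedgeC_apply {a : E → E [⋀^Fin k]→L[ℝ] ℝ} {b : E → E [⋀^Fin l]→L[ℝ] ℝ} {x : E}
    (ha : DifferentiableAt ℝ a x) (hb : DifferentiableAt ℝ b x) (v : Fin (k + l + 1) → E) :
    extDeriv (fun y => wedgeC (a y) (b y)) x v =
      wedgeC (extDeriv a x) (b x) (v ∘ Fin.cast (Nat.add_right_comm k 1 l)) +
        (-1 : ℝ) ^ k * wedgeC (a x) (extDeriv b x) v := by
  have hfderiv : fderiv ℝ (fun y => wedgeCLM k l (a y) (b y)) x =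
      wedgeCLM k l (a x) ∘L fderiv ℝ b x + (wedgeCLM k l).flip (b x) ∘L fderiv ℝ a x := by
    rw [((wedgeCLM k l).hasFDerivAt_of_bilinear ha.hasFDerivAt hb.hasFDerivAt).fderiv]
    ext1 w
    simp
  simp only [← wedgeCLM_apply, extDeriv]
  rw [hfderiv, ContinuousAlternatingMap.alternatizeUncurryFin_add,
    ContinuousAlternatingMap.add_apply,
    alternatizeUncurryFin_wedgeC_left_apply, alternatizeUncurryFin_wedgeC_right, add_comm]
  rfl

end ContinuousWedge

section ManifoldForms

variable {E : Type*} [NormedAddCommGroup E] [NormedSpace ℝ E]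
  {M : Type*} [TopologicalSpace M] [ChartedSpace E M] {k l : ℕ}

theorem compContinuousLinearMap_inChart (α : RawForm E M k) {e : OpenPartialHomeomorph M E}
    (he : e ∈ IsManifold.maximalAtlas 𝓘(ℝ, E) ∞ M) {x : M} (hx : x ∈ e.source) :
    (inChart α e (e x)).compContinuousLinearMap (mfderiv 𝓘(ℝ, E) 𝓘(ℝ, E) e x) = α x := by
  have hα : ∀ z, z = x → (α z : E [⋀^Fin k]→L[ℝ] ℝ) = α x := by rintro z rfl; rfl
  ext v
  refine (DFunLike.congr_fun (hα (e.symm (e x)) (e.left_inv hx)) _).trans ?_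
  exact congrArg (α x) (funext fun i => mfderiv_chart_symm_chart he hx (v i))

theorem inChart_eq_zero_iff {α : RawForm E M k} {e : OpenPartialHomeomorph M E}
    (he : e ∈ IsManifold.maximalAtlas 𝓘(ℝ, E) ∞ M) {y : E} (hy : y ∈ e.target) :
    inChart α e y = 0 ↔ α (e.symm y) = 0 := by
  refine ⟨fun h => ?_, fun h => ?_⟩
  · rw [← compContinuousLinearMap_inChart α he (e.map_target hy), e.right_inv hy, h]
    rfl
  · rw [inChart, h]
    rfl

/-- The wedge product of smooth forms. -/
def wedgeForm (α : DiffForm E M k) (β : DiffForm E M l) : DiffForm E M (k + l) :=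
  ⟨fun x => wedgeC (E := E) (α.1 x) (β.1 x), fun e he =>
    (contDiffOn_wedgeC (α.2 e he) (β.2 e he)).congr fun _ _ =>
      wedgeC_compContinuousLinearMap (E := E) (F := E) _ _ _⟩

theorem inChart_wedgeForm (α : DiffForm E M k) (β : DiffForm E M l)
    (e : OpenPartialHomeomorph M E) :
    inChart (wedgeForm α β).1 e = fun y => wedgeC (inChart α.1 e y) (inChart β.1 e y) :=
  funext fun _ => wedgeC_compContinuousLinearMap (E := E) (F := E) _ _ _

variable [IsManifold 𝓘(ℝ, E) ∞ M]

theorem d_apply_eq_zero_iff (α : DiffForm E M k) {e : OpenPartialHomeomorph M E}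
    (he : e ∈ IsManifold.maximalAtlas 𝓘(ℝ, E) ∞ M) {x : M} (hx : x ∈ e.source) :
    (d E M k α).1 x = 0 ↔ extDeriv (inChart α.1 e) (e x) = 0 := by
  rw [← inChart_rawD α.2 he (e.map_source hx), inChart_eq_zero_iff he (e.map_source hx),
    e.left_inv hx]
  rfl

theorem extDeriv_const (c : E [⋀^Fin k]→L[ℝ] ℝ) (y : E) : extDeriv (fun _ => c) y = 0 := by
  rw [extDeriv, fderiv_fun_const]
  exact map_zero (ContinuousAlternatingMap.alternatizeUncurryFinCLM ℝ E ℝ)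

theorem d_apply_eq_zero_of_eventually {α : DiffForm E M k} {x : M} (h : ∀ᶠ z in nhds x, α.1 z = 0) :
    (d E M k α).1 x = 0 := by
  have he : chartAt E x ∈ IsManifold.maximalAtlas 𝓘(ℝ, E) ∞ M := IsManifold.chart_mem_maximalAtlas x
  have hx := mem_chart_source E x
  have hα : inChart α.1 (chartAt E x) =ᶠ[nhds (chartAt E x x)] fun _ => 0 := by
    filter_upwards [(chartAt E x).open_target.mem_nhds (mem_chart_target E x),
      ((chartAt E x).tendsto_symm hx).eventually h] with y hy hzero
    exact (inChart_eq_zero_iff he hy).2 hzero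
  rw [d_apply_eq_zero_iff α he hx, hα.extDeriv_eq, extDeriv_const]

theorem d_wedgeForm_apply (α : DiffForm E M k) (β : DiffForm E M l) (x : M)
    (v : Fin (k + l + 1) → TangentSpace 𝓘(ℝ, E) x) :
    (d E M (k + l) (wedgeForm α β)).1 x v =
      (wedgeForm (d E M k α) β).1 x (v ∘ Fin.cast (Nat.add_right_comm k 1 l)) +
        (-1 : ℝ) ^ k * (wedgeForm α (d E M l β)).1 x v := by
  have he : chartAt E x ∈ IsManifold.maximalAtlas 𝓘(ℝ, E) ∞ M := IsManifold.chart_mem_maximalAtlas x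
  have hx := mem_chart_source E x
  have hrestrict {m : ℕ} (γ : DiffForm E M m) := compContinuousLinearMap_inChart γ.1 he hx
  have hd {m : ℕ} (γ : DiffForm E M m) : inChart (d E M m γ).1 (chartAt E x) (chartAt E x x) =
    extDeriv (inChart γ.1 (chartAt E x)) (chartAt E x x) :=
      inChart_rawD γ.2 he (mem_chart_target E x)
  rw [← hrestrict (d E M (k + l) (wedgeForm α β)), ← hrestrict (wedgeForm (d E M k α) β),
    ← hrestrict (wedgeForm α (d E M l β)), hd, inChart_wedgeForm, inChart_wedgeForm,
    inChart_wedgeForm]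
  beta_reduce
  rw [hd, hd]
  exact extDeriv_wedgeC_apply (differentiableAt_inChart α.2 x) (differentiableAt_inChart β.2 x) _

end ManifoldForms

section ClosedForms

variable {E : Type*} [NormedAddCommGroup E] [NormedSpace ℝ E]
  {M : Type*} [TopologicalSpace M] [ChartedSpace E M] {k l : ℕ}

theorem zero_wedgeForm (β : DiffForm E M l) : wedgeForm (0 : DiffForm E M k) β = 0 :=
  Subtype.ext <| funext fun x => (wedgeCLM (E := E) k l).map_zero₂ (β.1 x)

theorem wedgeForm_zero (α : DiffForm E M k) : wedgeForm α (0 : DiffForm E M l) = 0 :=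
  Subtype.ext <| funext fun x => (wedgeCLM (E := E) k l (α.1 x)).map_zero

/-- The constant function `1`, as a `0`-form. -/
def unitForm : DiffForm E M 0 :=
  ⟨fun _ => ContinuousAlternatingMap.constOfIsEmpty ℝ E (Fin 0) 1, fun _ _ =>
    contDiffOn_const (c := ContinuousAlternatingMap.constOfIsEmpty ℝ E (Fin 0) 1)⟩

/-- The exterior powers of a smooth `2`-form. -/
def powForm (Ω : DiffForm E M 2) : (m : ℕ) → DiffForm E M (2 * m)
  | 0 => unitForm
  | m + 1 => wedgeForm (powForm Ω m) Ω

theorem toAlternatingMap_powForm_apply (Ω : DiffForm E M 2) (m : ℕ) (x : M) :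
    ((powForm Ω m).1 x).toAlternatingMap = wedgePow (Ω.1 x).toAlternatingMap m := by
  induction m with
  | zero => rfl
  | succ m ih => exact congrArg (fun a => wedge a (Ω.1 x).toAlternatingMap) ih

variable [IsManifold 𝓘(ℝ, E) ∞ M]

theorem d_wedgeForm_apply_of_closed_left {α : DiffForm E M k} (hα : α ∈ closedForms E M k)
    (β : DiffForm E M l) (x : M) (v : Fin (k + l + 1) → TangentSpace 𝓘(ℝ, E) x) :
    (d E M (k + l) (wedgeForm α β)).1 x v = (-1 : ℝ) ^ k * (wedgeForm α (d E M l β)).1 x v := by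
  have hzero : wedgeForm (d E M k α) β = 0 := by rw [LinearMap.mem_ker.1 hα, zero_wedgeForm]
  rw [d_wedgeForm_apply, hzero]
  exact zero_add _

theorem d_wedgeForm_apply_of_closed_right (α : DiffForm E M k) {β : DiffForm E M l}
    (hβ : β ∈ closedForms E M l) (x : M) (v : Fin (k + l + 1) → TangentSpace 𝓘(ℝ, E) x) :
    (d E M (k + l) (wedgeForm α β)).1 x v =
      (wedgeForm (d E M k α) β).1 x (v ∘ Fin.cast (Nat.add_right_comm k 1 l)) := by
  have hzero : wedgeForm α (d E M l β) = 0 := by rw [LinearMap.mem_ker.1 hβ, wedgeForm_zero]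
  rw [d_wedgeForm_apply, hzero]
  exact (congrArg _ (mul_zero _)).trans (add_zero _)

theorem wedgeForm_mem_closedForms {α : DiffForm E M k} (hα : α ∈ closedForms E M k)
    {β : DiffForm E M l} (hβ : β ∈ closedForms E M l) :
    wedgeForm α β ∈ closedForms E M (k + l) := by
  have hzero : wedgeForm α (d E M l β) = 0 := by rw [LinearMap.mem_ker.1 hβ, wedgeForm_zero]
  refine LinearMap.mem_ker.2 <| Subtype.ext <| funext fun x =>
    ContinuousAlternatingMap.ext fun v => ?_
  rw [d_wedgeForm_apply_of_closed_left hα, hzero]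
  exact mul_zero _

theorem unitForm_mem_closedForms : unitForm ∈ closedForms E M 0 :=
  LinearMap.mem_ker.2 <| Subtype.ext <| funext fun x =>
    (d_apply_eq_zero_iff unitForm (IsManifold.chart_mem_maximalAtlas x) (mem_chart_source E x)).2 <|
      extDeriv_const (ContinuousAlternatingMap.constOfIsEmpty ℝ E (Fin 0) (1 : ℝ)) _

theorem powForm_mem_closedForms {Ω : DiffForm E M 2} (hΩ : Ω ∈ closedForms E M 2) (m : ℕ) :
    powForm Ω m ∈ closedForms E M (2 * m) := by
  induction m with
  | zero => exact unitForm_mem_closedForms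
  | succ m ih => exact wedgeForm_mem_closedForms ih hΩ

end ClosedForms

section CompactSupport

variable {E : Type*} [NormedAddCommGroup E] [NormedSpace ℝ E]
  {M : Type*} [TopologicalSpace M] [ChartedSpace E M] {k : ℕ}

/-- Multiplication of smooth forms by a smooth function. -/
def smulForm (f : C^∞⟮𝓘(ℝ, E), M; ℝ⟯) : DiffForm E M k →ₗ[ℝ] DiffForm E M k where
  toFun α := ⟨fun x => f x • α.1 x, fun e he =>
    ((f.contMDiff.comp_contMDiffOn
      (contMDiffOn_symm_of_mem_maximalAtlas he)).contDiffOn.smul (α.2 e he) :)⟩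
  map_add' _ _ := Subtype.ext <| funext fun _ => smul_add _ _ _
  map_smul' c α := Subtype.ext <| funext fun x => smul_comm (f x) c (α.1 x)

theorem smulForm_apply (f : C^∞⟮𝓘(ℝ, E), M; ℝ⟯) (α : DiffForm E M k) (x : M) :
    (smulForm f α).1 x = f x • α.1 x := rfl

theorem sum_smulForm {ι : Type*} [Fintype ι] (ρ : SmoothPartitionOfUnity ι 𝓘(ℝ, E) M)
    (α : DiffForm E M k) : ∑ i, smulForm (ρ i) α = α := by
  refine Subtype.ext <| funext fun x => ?_
  have hρ : ∑ i, ρ i x = 1 := by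
    rw [← finsum_eq_sum_of_fintype, ρ.sum_eq_one (Set.mem_univ x)]
  rw [Submodule.coe_sum, Finset.sum_apply]
  simp only [smulForm_apply]
  rw [← Finset.sum_smul, hρ, one_smul]

/-- The form `α` vanishes outside some compact subset of `U`. -/
def IsCompactlySupportedIn (α : DiffForm E M k) (U : Set M) : Prop :=
  ∃ K ⊆ U, IsCompact K ∧ ∀ x ∉ K, α.1 x = 0

namespace IsCompactlySupportedIn

variable {α : DiffForm E M k} {U : Set M}

theorem eq_zero (hα : IsCompactlySupportedIn α U) {x : M} (hx : x ∉ U) : α.1 x = 0 := by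
  obtain ⟨K, hKU, -, hzero⟩ := hα
  exact hzero x fun h => hx (hKU h)

theorem smulForm (hα : IsCompactlySupportedIn α U) (f : C^∞⟮𝓘(ℝ, E), M; ℝ⟯) :
    IsCompactlySupportedIn (smulForm f α) U := by
  obtain ⟨K, hKU, hK, hzero⟩ := hα
  exact ⟨K, hKU, hK, fun x hx => by rw [smulForm_apply, hzero x hx, smul_zero]⟩

theorem d [IsManifold 𝓘(ℝ, E) ∞ M] [T2Space M] (hα : IsCompactlySupportedIn α U) :
    IsCompactlySupportedIn (d E M k α) U := by
  obtain ⟨K, hKU, hK, hzero⟩ := hα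
  exact ⟨K, hKU, hK, fun x hx => d_apply_eq_zero_of_eventually <|
    Filter.mem_of_superset (hK.isClosed.isOpen_compl.mem_nhds hx) hzero⟩

end IsCompactlySupportedIn

theorem isCompactlySupportedIn_smulForm [CompactSpace M] {f : C^∞⟮𝓘(ℝ, E), M; ℝ⟯} {U : Set M}
    (hf : tsupport f ⊆ U) (α : DiffForm E M k) : IsCompactlySupportedIn (smulForm f α) U :=
  ⟨tsupport f, hf, (isClosed_tsupport f).isCompact, fun x hx => by
    rw [smulForm_apply, image_eq_zero_of_notMem_tsupport hx, zero_smul]⟩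

theorem IsCompactlySupportedIn.exists_isCompact_inChart_eq_zero {α : DiffForm E M k}
    {e : OpenPartialHomeomorph M E} (he : e ∈ IsManifold.maximalAtlas 𝓘(ℝ, E) ∞ M)
    (hα : IsCompactlySupportedIn α e.source) :
    ∃ K ⊆ e.target, IsCompact K ∧ ∀ y ∈ e.target \ K, inChart α.1 e y = 0 := by
  obtain ⟨K, hKe, hK, hzero⟩ := hα
  refine ⟨e '' K, ?_, hK.image_of_continuousOn (e.continuousOn.mono hKe), fun y hy => ?_⟩
  · rintro _ ⟨x, hx, rfl⟩
    exact e.map_source (hKe hx)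
  · exact (inChart_eq_zero_iff he hy.1).2 <|
      hzero _ fun h => hy.2 ⟨e.symm y, h, e.right_inv hy.1⟩

end CompactSupport

section EuclideanStokes

open MeasureTheory

variable {E : Type*} [NormedAddCommGroup E] [NormedSpace ℝ E] [FiniteDimensional ℝ E]
  [MeasurableSpace E] [BorelSpace E] (ν : Measure E) [ν.IsAddHaarMeasure] {m : ℕ}

theorem integral_fderiv_apply_eq_zero {g : E → ℝ} (hg : ContDiff ℝ 1 g)
    (hs : HasCompactSupport g) (v : E) : ∫ y, fderiv ℝ g y v ∂ν = 0 := by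
  have hderiv : Continuous fun y => fderiv ℝ g y v :=
    (hg.continuous_fderiv (by simp)).clm_apply continuous_const
  have hparts := integral_mul_fderiv_eq_neg_fderiv_mul_of_integrable (μ := ν) (g := g) (v := v)
    (f := fun _ => (1 : ℝ)) (by simp)
    (by simpa using hderiv.integrable_of_hasCompactSupport (hs.fderiv_apply ℝ v))
    (by simpa using hg.continuous.integrable_of_hasCompactSupport hs)
    (fun x _ => by fun_prop) (fun x _ => hg.differentiable (by simp) x)
  simpa using hparts

theorem integral_extDeriv_apply_eq_zero {g : E → E [⋀^Fin m]→L[ℝ] ℝ} (hg : ContDiff ℝ 1 g)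
    (hs : HasCompactSupport g) (v : Fin (m + 1) → E) : ∫ y, extDeriv g y v ∂ν = 0 := by
  have hg_apply : ∀ i : Fin (m + 1), ContDiff ℝ 1 fun y => g y (i.removeNth v) := fun i =>
    (ContinuousAlternatingMap.apply ℝ E ℝ (i.removeNth v)).contDiff.comp hg
  have hs_apply : ∀ i : Fin (m + 1), HasCompactSupport fun y => g y (i.removeNth v) := fun i =>
    hs.comp_left (g := fun a : E [⋀^Fin m]→L[ℝ] ℝ => a (i.removeNth v)) rfl
  simp only [fun y => extDeriv_apply (hg.differentiable (by simp) y) v, zsmul_eq_mul]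
  rw [integral_finsetSum]
  · refine Finset.sum_eq_zero fun i _ => ?_
    rw [integral_const_mul, integral_fderiv_apply_eq_zero ν (hg_apply i) (hs_apply i), mul_zero]
  · intro i _
    exact (Continuous.integrable_of_hasCompactSupport
      (((hg_apply i).continuous_fderiv (by simp)).clm_apply continuous_const)
      ((hs_apply i).fderiv_apply ℝ _)).const_mul _

theorem setIntegral_extDeriv_apply_eq_zero {g : E → E [⋀^Fin m]→L[ℝ] ℝ} {U K : Set E}
    (hU : IsOpen U) (hg : ContDiffOn ℝ 1 g U) (hK : IsCompact K) (hKU : K ⊆ U)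
    (hzero : ∀ y ∈ U \ K, g y = 0) (v : Fin (m + 1) → E) :
    ∫ y in U, extDeriv g y v ∂ν = 0 := by
  set G := U.indicator g
  have hG_of_notMem : ∀ y ∉ K, G y = 0 := fun y hy => by
    by_cases hyU : y ∈ U
    · exact (Set.indicator_of_mem hyU g).trans (hzero y ⟨hyU, hy⟩)
    · exact Set.indicator_of_notMem hyU g
  have hG_of_mem : ∀ y ∈ U, G =ᶠ[nhds y] g := fun y hy =>
    Filter.mem_of_superset (hU.mem_nhds hy) fun z hz => Set.indicator_of_mem hz g
  have hG_zero : ∀ y ∉ U, G =ᶠ[nhds y] fun _ => 0 := fun y hy =>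
    Filter.mem_of_superset (hK.isClosed.isOpen_compl.mem_nhds fun h => hy (hKU h)) hG_of_notMem
  have hG : ContDiff ℝ 1 G := contDiff_iff_contDiffAt.2 fun y => by
    by_cases hy : y ∈ U
    · exact (hg.contDiffAt (hU.mem_nhds hy)).congr_of_eventuallyEq (hG_of_mem y hy)
    · exact contDiffAt_const.congr_of_eventuallyEq (hG_zero y hy)
  calc ∫ y in U, extDeriv g y v ∂ν = ∫ y in U, extDeriv G y v ∂ν :=
        setIntegral_congr_fun hU.measurableSet fun y hy =>
          congrArg (· v) (hG_of_mem y hy).extDeriv_eq.symm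
    _ = ∫ y, extDeriv G y v ∂ν := setIntegral_eq_integral_of_forall_compl_eq_zero fun y hy => by
        rw [(hG_zero y hy).extDeriv_eq, extDeriv_const]
        rfl
    _ = 0 := integral_extDeriv_apply_eq_zero ν hG (HasCompactSupport.intro hK hG_of_notMem) v

end EuclideanStokes

section ChartIntegral

open MeasureTheory Module

variable {E : Type*} [NormedAddCommGroup E] [NormedSpace ℝ E]
  {M : Type*} [TopologicalSpace M] [ChartedSpace E M] {m : ℕ} (b : Basis (Fin m) ℝ E)

/-- The coefficient of a top degree form in a chart, with respect to a basis of the model space. -/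
def chartCoeff (τ : RawForm E M m) (e : OpenPartialHomeomorph M E) (y : E) : ℝ := inChart τ e y b

/-- The coefficient of the top degree form `τ` in the chart `e`, for the orientation of `M` given
by the nowhere vanishing form `μ`. -/
def orientedCoeff (μ τ : RawForm E M m) (e : OpenPartialHomeomorph M E) (y : E) : ℝ :=
  (SignType.sign (chartCoeff b μ e y) : ℝ) * chartCoeff b τ e y

theorem chartCoeff_change (τ : RawForm E M m) {e e' : OpenPartialHomeomorph M E}
    (he : e ∈ IsManifold.maximalAtlas 𝓘(ℝ, E) ∞ M) (he' : e' ∈ IsManifold.maximalAtlas 𝓘(ℝ, E) ∞ M)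
    {y : E} (hy : y ∈ e.target) (hy' : e.symm y ∈ e'.source) :
    chartCoeff b τ e y =
      (fderiv ℝ (e' ∘ e.symm) y).det * chartCoeff b τ e' ((e' ∘ e.symm) y) := by
  rw [chartCoeff, inChart_change τ he he' hy hy']
  set f := inChart τ e' ((e' ∘ e.symm) y)
  set L := fderiv ℝ (e' ∘ e.symm) y
  have hdet : b.det (L ∘ b) = L.det := by
    simpa [b.det_self] using b.det_comp L.toLinearMap b
  calc f (L ∘ b) = f b * b.det (L ∘ b) :=
        congrArg (fun g : E [⋀^Fin m]→ₗ[ℝ] ℝ => g (L ∘ b)) (f.toAlternatingMap.eq_smul_basis_det b)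
    _ = L.det * f b := by rw [hdet, mul_comm]

theorem orientedCoeff_change (μ τ : RawForm E M m) {e e' : OpenPartialHomeomorph M E}
    (he : e ∈ IsManifold.maximalAtlas 𝓘(ℝ, E) ∞ M) (he' : e' ∈ IsManifold.maximalAtlas 𝓘(ℝ, E) ∞ M)
    {y : E} (hy : y ∈ e.target) (hy' : e.symm y ∈ e'.source) :
    orientedCoeff b μ τ e y =
      |(fderiv ℝ (e' ∘ e.symm) y).det| * orientedCoeff b μ τ e' ((e' ∘ e.symm) y) := by
  rw [orientedCoeff, orientedCoeff, chartCoeff_change b μ he he' hy hy',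
    chartCoeff_change b τ he he' hy hy', sign_mul, ← sign_mul_self, SignType.coe_mul]
  ring

theorem orientedCoeff_eq_zero (μ : RawForm E M m) {τ : RawForm E M m}
    {e : OpenPartialHomeomorph M E} {y : E} (h : inChart τ e y = 0) :
    orientedCoeff b μ τ e y = 0 := by
  rw [orientedCoeff, show chartCoeff b τ e y = 0 from congrArg (fun f => f b) h, mul_zero]

theorem orientedCoeff_sum {ι : Type*} [Fintype ι] (μ : RawForm E M m) (τ : ι → RawForm E M m)
    (e : OpenPartialHomeomorph M E) (y : E) :
    orientedCoeff b μ (∑ i, τ i) e y = ∑ i, orientedCoeff b μ (τ i) e y := by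
  have hsum : chartCoeff b (∑ i, τ i) e y = ∑ i, chartCoeff b (τ i) e y :=
    map_sum (AddMonoidHom.mk' (fun σ : RawForm E M m => chartCoeff b σ e y) fun _ _ => rfl) τ _
  simp only [orientedCoeff, hsum, Finset.mul_sum]

theorem orientedCoeff_smulForm_self (f : C^∞⟮𝓘(ℝ, E), M; ℝ⟯) (μ : DiffForm E M m)
    (e : OpenPartialHomeomorph M E) (y : E) :
    orientedCoeff b μ.1 (smulForm f μ).1 e y = f (e.symm y) * |chartCoeff b μ.1 e y| := by
  rw [← sign_mul_self, mul_left_comm]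
  rfl

theorem contDiffOn_chartCoeff (τ : DiffForm E M m) {e : OpenPartialHomeomorph M E}
    (he : e ∈ IsManifold.maximalAtlas 𝓘(ℝ, E) ∞ M) :
    ContDiffOn ℝ ∞ (chartCoeff b τ.1 e) e.target :=
  (ContinuousAlternatingMap.apply ℝ E ℝ b).contDiff.comp_contDiffOn (τ.2 e he)

theorem chartCoeff_ne_zero {μ : RawForm E M m} (hμ : ∀ x, μ x ≠ 0) {e : OpenPartialHomeomorph M E}
    (he : e ∈ IsManifold.maximalAtlas 𝓘(ℝ, E) ∞ M) {y : E} (hy : y ∈ e.target) :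
    chartCoeff b μ e y ≠ 0 := by
  have hne : (inChart μ e y).toAlternatingMap ≠ 0 := fun hzero =>
    hμ (e.symm y) <| (inChart_eq_zero_iff he hy).1 <|
      ContinuousAlternatingMap.toAlternatingMap_injective hzero
  exact (AlternatingMap.map_basis_ne_zero_iff b _).2 hne

section Orientation

variable {μ : DiffForm E M m} (hμ : ∀ x, μ.1 x ≠ 0) {e : OpenPartialHomeomorph M E}
  (he : e ∈ IsManifold.maximalAtlas 𝓘(ℝ, E) ∞ M)

include hμ he

theorem eventually_sign_chartCoeff_eq {y : E} (hy : y ∈ e.target) :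
    ∀ᶠ z in nhds y,
      SignType.sign (chartCoeff b μ.1 e z) = SignType.sign (chartCoeff b μ.1 e y) := by
  have hcoeff : ContinuousAt (chartCoeff b μ.1 e) y :=
    (contDiffOn_chartCoeff b μ he).continuousOn.continuousAt (e.open_target.mem_nhds hy)
  have hsign : ContinuousAt (fun z => SignType.sign (chartCoeff b μ.1 e z)) y :=
    (continuousAt_sign_of_ne_zero (chartCoeff_ne_zero b hμ he hy)).comp hcoeff
  exact hsign.eventually ((isOpen_discrete {_}).mem_nhds rfl)

theorem continuousOn_orientedCoeff (τ : DiffForm E M m) :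
    ContinuousOn (orientedCoeff b μ.1 τ.1 e) e.target := fun y hy => by
  have hcoeff : ContinuousAt (chartCoeff b τ.1 e) y :=
    (contDiffOn_chartCoeff b τ he).continuousOn.continuousAt (e.open_target.mem_nhds hy)
  refine ((hcoeff.const_mul (SignType.sign (chartCoeff b μ.1 e y) : ℝ)).congr
    ?_).continuousWithinAt
  filter_upwards [eventually_sign_chartCoeff_eq b hμ he hy] with z hz
  rw [orientedCoeff, hz]

theorem integrableOn_orientedCoeff [MeasurableSpace E] [BorelSpace E] (ν : Measure E)
    [IsFiniteMeasureOnCompacts ν] {τ : DiffForm E M m} (hτ : IsCompactlySupportedIn τ e.source) :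
    IntegrableOn (orientedCoeff b μ.1 τ.1 e) e.target ν := by
  obtain ⟨K, hKe, hK, hzero⟩ := hτ.exists_isCompact_inChart_eq_zero he
  exact IntegrableOn.of_forall_sdiff_eq_zero
    (((continuousOn_orientedCoeff b hμ he τ).mono hKe).integrableOn_compact hK)
    e.open_target.measurableSet fun y hy => orientedCoeff_eq_zero b μ.1 (hzero y hy)

end Orientation

variable [MeasurableSpace E] (ν : Measure E)

/-- The integral of the top degree form `τ` over the domain of the chart `e`, for the orientation
given by `μ`. -/
def chartIntegral (μ τ : RawForm E M m) (e : OpenPartialHomeomorph M E) : ℝ :=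
  ∫ y in e.target, orientedCoeff b μ τ e y ∂ν

theorem chartIntegral_smulForm_nonneg {f : C^∞⟮𝓘(ℝ, E), M; ℝ⟯} (hf : ∀ x, 0 ≤ f x)
    (μ : DiffForm E M m) (e : OpenPartialHomeomorph M E) :
    0 ≤ chartIntegral b ν μ.1 (smulForm f μ).1 e := by
  refine integral_nonneg fun y => ?_
  rw [orientedCoeff_smulForm_self]
  exact mul_nonneg (hf _) (abs_nonneg _)

variable [BorelSpace E]

theorem chartIntegral_sum [IsFiniteMeasureOnCompacts ν] {μ : DiffForm E M m} (hμ : ∀ x, μ.1 x ≠ 0)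
    {e : OpenPartialHomeomorph M E} (he : e ∈ IsManifold.maximalAtlas 𝓘(ℝ, E) ∞ M) {ι : Type*}
    [Fintype ι] {τ : ι → DiffForm E M m} (hτ : ∀ i, IsCompactlySupportedIn (τ i) e.source) :
    chartIntegral b ν μ.1 (∑ i, τ i : DiffForm E M m).1 e =
      ∑ i, chartIntegral b ν μ.1 (τ i).1 e := by
  simp only [chartIntegral, Submodule.coe_sum, orientedCoeff_sum]
  exact integral_finsetSum _ fun i _ => integrableOn_orientedCoeff b hμ he ν (hτ i)

theorem chartIntegral_smulForm_pos [IsFiniteMeasureOnCompacts ν] [ν.IsOpenPosMeasure]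
    {μ : DiffForm E M m} (hμ : ∀ x, μ.1 x ≠ 0)
    {e : OpenPartialHomeomorph M E} (he : e ∈ IsManifold.maximalAtlas 𝓘(ℝ, E) ∞ M)
    {f : C^∞⟮𝓘(ℝ, E), M; ℝ⟯} (hf : ∀ x, 0 ≤ f x)
    (hfμ : IsCompactlySupportedIn (smulForm f μ) e.source) {x : M} (hx : f x ≠ 0) :
    0 < chartIntegral b ν μ.1 (smulForm f μ).1 e := by
  have hxe : x ∈ e.source := by
    by_contra hxe
    exact smul_ne_zero hx (hμ x) (hfμ.eq_zero hxe)
  have hopen : IsOpen (e.target ∩ e.symm ⁻¹' {z | f z ≠ 0}) :=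
    e.isOpen_inter_preimage_symm (isOpen_ne_fun f.contMDiff.continuous continuous_const)
  have hmem : e x ∈ e.target ∩ e.symm ⁻¹' {z | f z ≠ 0} :=
    ⟨e.map_source hxe, by simpa [e.left_inv hxe] using hx⟩
  refine (setIntegral_pos_iff_support_of_nonneg_ae (Filter.Eventually.of_forall fun y => ?_)
    (integrableOn_orientedCoeff b hμ he ν hfμ)).2 <|
      (hopen.measure_pos ν ⟨_, hmem⟩).trans_le <| measure_mono fun y hy => ⟨?_, hy.1⟩
  · exact (mul_nonneg (hf _) (abs_nonneg _)).trans_eq (orientedCoeff_smulForm_self b f μ e y).symm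
  · rw [Function.mem_support, orientedCoeff_smulForm_self]
    exact mul_ne_zero hy.2 (abs_ne_zero.2 (chartCoeff_ne_zero b hμ he hy.1))

variable [FiniteDimensional ℝ E] [ν.IsAddHaarMeasure]

theorem chartIntegral_change (μ : RawForm E M m) {τ : RawForm E M m}
    {e e' : OpenPartialHomeomorph M E} (he : e ∈ IsManifold.maximalAtlas 𝓘(ℝ, E) ∞ M)
    (he' : e' ∈ IsManifold.maximalAtlas 𝓘(ℝ, E) ∞ M) (h : ∀ x ∉ e.source, τ x = 0)
    (h' : ∀ x ∉ e'.source, τ x = 0) :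
    chartIntegral b ν μ τ e = chartIntegral b ν μ τ e' := by
  set φ : OpenPartialHomeomorph E E := e.symm.trans e' with hφ
  have hsource : ∀ y, y ∈ φ.source ↔ y ∈ e.target ∧ e.symm y ∈ e'.source := by simp [hφ]
  have htarget : ∀ y, y ∈ φ.target ↔ y ∈ e'.target ∧ e'.symm y ∈ e.source := by simp [hφ]
  have hφ' : ∀ y ∈ φ.source,
      HasFDerivWithinAt φ (fderiv ℝ (e' ∘ e.symm) y) φ.source y := fun y hy =>
    ((contDiffAt_transition he he' ((hsource y).1 hy).1 ((hsource y).1 hy).2).differentiableAt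
      (by simp)).hasFDerivAt.hasFDerivWithinAt
  calc chartIntegral b ν μ τ e = ∫ y in φ.source, orientedCoeff b μ τ e y ∂ν :=
        setIntegral_eq_of_subset_of_forall_sdiff_eq_zero e.open_target.measurableSet
          (fun y hy => ((hsource y).1 hy).1) fun y hy => orientedCoeff_eq_zero b μ <|
            (inChart_eq_zero_iff he hy.1).2 <| h' _ fun hy' => hy.2 ((hsource y).2 ⟨hy.1, hy'⟩)
    _ = ∫ y in φ.source,
          |(fderiv ℝ (e' ∘ e.symm) y).det| • orientedCoeff b μ τ e' (φ y) ∂ν :=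
        setIntegral_congr_fun φ.open_source.measurableSet fun y hy =>
          orientedCoeff_change b μ τ he he' ((hsource y).1 hy).1 ((hsource y).1 hy).2
    _ = ∫ y in φ.target, orientedCoeff b μ τ e' y ∂ν := by
        rw [← φ.image_source_eq_target, integral_image_eq_integral_abs_det_fderiv_smul ν
          φ.open_source.measurableSet hφ' φ.injOn]
    _ = chartIntegral b ν μ τ e' :=
        (setIntegral_eq_of_subset_of_forall_sdiff_eq_zero e'.open_target.measurableSet
          (fun y hy => ((htarget y).1 hy).1) fun y hy => orientedCoeff_eq_zero b μ <|
            (inChart_eq_zero_iff he' hy.1).2 <| h _ fun hy' =>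
              hy.2 ((htarget y).2 ⟨hy.1, hy'⟩)).symm

theorem chartIntegral_d_eq_zero [IsManifold 𝓘(ℝ, E) ∞ M] (b : Basis (Fin (m + 1)) ℝ E)
    {μ : DiffForm E M (m + 1)} (hμ : ∀ x, μ.1 x ≠ 0) {e : OpenPartialHomeomorph M E}
    (he : e ∈ IsManifold.maximalAtlas 𝓘(ℝ, E) ∞ M) {α : DiffForm E M m}
    (hα : IsCompactlySupportedIn α e.source) :
    chartIntegral b ν μ.1 (d E M m α).1 e = 0 := by
  obtain ⟨K, hKe, hK, hzero⟩ := hα.exists_isCompact_inChart_eq_zero he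
  set g : E → E [⋀^Fin m]→L[ℝ] ℝ := fun y =>
    (SignType.sign (chartCoeff b μ.1 e y) : ℝ) • inChart α.1 e y with hg
  have hg_local : ∀ y ∈ e.target, g =ᶠ[nhds y]
      (SignType.sign (chartCoeff b μ.1 e y) : ℝ) • inChart α.1 e := fun y hy => by
    filter_upwards [eventually_sign_chartCoeff_eq b hμ he hy] with z hz
    simp only [hg, hz, Pi.smul_apply]
  have hg_contDiff : ContDiffOn ℝ 1 g e.target := fun y hy =>
    ((((α.2 e he).of_le (by exact_mod_cast le_top)).contDiffAt
      (e.open_target.mem_nhds hy)).const_smul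
        (SignType.sign (chartCoeff b μ.1 e y) : ℝ)).congr_of_eventuallyEq
          (hg_local y hy) |>.contDiffWithinAt
  have hg_zero : ∀ y ∈ e.target \ K, g y = 0 := fun y hy => by
    simp only [hg, hzero y hy, smul_zero]
  rw [← setIntegral_extDeriv_apply_eq_zero ν e.open_target hg_contDiff hK hKe hg_zero b]
  refine setIntegral_congr_fun e.open_target.measurableSet fun y hy => ?_
  simp only [(hg_local y hy).extDeriv_eq, extDeriv_smul, ← inChart_rawD α.2 he hy]
  rfl

end ChartIntegral

section Stokes

open MeasureTheory Module

variable {E : Type*} [NormedAddCommGroup E] [NormedSpace ℝ E] [MeasurableSpace E]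
  {M : Type*} [TopologicalSpace M] [ChartedSpace E M] {m : ℕ} {ι : Type*} [Fintype ι]

/-- The integral over `M` of the top degree form `τ`, for the orientation given by the nowhere
vanishing form `μ`, computed with the charts `e i` and the partition of unity `ρ`, whose members are
meant to be supported in the domains of these charts. -/
def formIntegral (b : Basis (Fin m) ℝ E) (ν : Measure E) (e : ι → OpenPartialHomeomorph M E)
    (ρ : SmoothPartitionOfUnity ι 𝓘(ℝ, E) M) (μ τ : DiffForm E M m) : ℝ :=
  ∑ i, chartIntegral b ν μ.1 (smulForm (ρ i) τ).1 (e i)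

variable [CompactSpace M] [BorelSpace E] (ν : Measure E)
  {e : ι → OpenPartialHomeomorph M E} (he : ∀ i, e i ∈ IsManifold.maximalAtlas 𝓘(ℝ, E) ∞ M)
  {ρ : SmoothPartitionOfUnity ι 𝓘(ℝ, E) M} (hρ : ρ.IsSubordinate fun i => (e i).source)

section

variable (b : Basis (Fin m) ℝ E) {μ : DiffForm E M m} (hμ : ∀ x, μ.1 x ≠ 0)

include he hρ hμ

theorem formIntegral_sum [IsFiniteMeasureOnCompacts ν] {κ : Type*} [Fintype κ]
    (τ : κ → DiffForm E M m) :
    formIntegral b ν e ρ μ (∑ j, τ j) = ∑ j, formIntegral b ν e ρ μ (τ j) := by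
  simp only [formIntegral]
  rw [Finset.sum_comm]
  refine Finset.sum_congr rfl fun i _ => ?_
  rw [map_sum, chartIntegral_sum b ν hμ (he i) fun j => isCompactlySupportedIn_smulForm (hρ i) _]

theorem formIntegral_self_pos [IsFiniteMeasureOnCompacts ν] [ν.IsOpenPosMeasure] [Nonempty M] :
    0 < formIntegral b ν e ρ μ μ := by
  obtain ⟨x⟩ := ‹Nonempty M›
  obtain ⟨i, hi⟩ := ρ.exists_pos_of_mem (Set.mem_univ x)
  exact Finset.sum_pos' (fun j _ => chartIntegral_smulForm_nonneg b ν (ρ.nonneg j) μ (e j))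
    ⟨i, Finset.mem_univ i, chartIntegral_smulForm_pos b ν hμ (he i) (ρ.nonneg i)
      (isCompactlySupportedIn_smulForm (hρ i) μ) hi.ne'⟩

theorem formIntegral_eq_chartIntegral [FiniteDimensional ℝ E] [ν.IsAddHaarMeasure]
    {e' : OpenPartialHomeomorph M E} (he' : e' ∈ IsManifold.maximalAtlas 𝓘(ℝ, E) ∞ M)
    {τ : DiffForm E M m} (hτ : IsCompactlySupportedIn τ e'.source) :
    formIntegral b ν e ρ μ τ = chartIntegral b ν μ.1 τ.1 e' := by
  calc formIntegral b ν e ρ μ τ = ∑ i, chartIntegral b ν μ.1 (smulForm (ρ i) τ).1 e' :=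
        Finset.sum_congr rfl fun i _ => chartIntegral_change b ν μ.1 (he i) he'
          (fun _ => (isCompactlySupportedIn_smulForm (hρ i) τ).eq_zero)
          (fun _ => (hτ.smulForm (ρ i)).eq_zero)
    _ = chartIntegral b ν μ.1 τ.1 e' := by
        rw [← chartIntegral_sum b ν hμ he' fun i => hτ.smulForm (ρ i), sum_smulForm]

end

include he hρ in
theorem formIntegral_d_eq_zero [FiniteDimensional ℝ E] [ν.IsAddHaarMeasure]
    [IsManifold 𝓘(ℝ, E) ∞ M] [T2Space M] (b : Basis (Fin (m + 1)) ℝ E)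
    {μ : DiffForm E M (m + 1)} (hμ : ∀ x, μ.1 x ≠ 0) (β : DiffForm E M m) :
    formIntegral b ν e ρ μ (d E M m β) = 0 := by
  rw [← sum_smulForm ρ β, map_sum, formIntegral_sum ν he hρ b hμ]
  refine Finset.sum_eq_zero fun j _ => ?_
  have hβ : IsCompactlySupportedIn (smulForm (ρ j) β) (e j).source :=
    isCompactlySupportedIn_smulForm (hρ j) β
  rw [formIntegral_eq_chartIntegral ν he hρ b hμ (he j) hβ.d,
    chartIntegral_d_eq_zero ν b hμ (he j) hβ]

omit [MeasurableSpace E] [BorelSpace E] in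
theorem exists_smoothPartitionOfUnity_isSubordinate_chartAt [FiniteDimensional ℝ E]
    [IsManifold 𝓘(ℝ, E) ∞ M] [T2Space M] :
    ∃ (t : Finset M) (ρ : SmoothPartitionOfUnity t 𝓘(ℝ, E) M),
      ρ.IsSubordinate fun x => (chartAt E x.1).source := by
  obtain ⟨t, -, ht⟩ := isCompact_univ.elim_nhds_subcover (fun x : M => (chartAt E x).source)
    fun x _ => (chartAt E x).open_source.mem_nhds (mem_chart_source E x)
  refine ⟨t, SmoothPartitionOfUnity.exists_isSubordinate 𝓘(ℝ, E) isClosed_univ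
    (fun x : t => (chartAt E x.1).source) (fun x => (chartAt E x.1).open_source) fun x hx => ?_⟩
  obtain ⟨z, hz, hxz⟩ := Set.mem_iUnion₂.1 (ht hx)
  exact Set.mem_iUnion.2 ⟨⟨z, hz⟩, hxz⟩

omit [MeasurableSpace E] [BorelSpace E] in
theorem exists_d_apply_eq_zero [IsManifold 𝓘(ℝ, E) ∞ M] [T2Space M] [Nonempty M]
    (hm : finrank ℝ E = m + 1) (β : DiffForm E M m) : ∃ x, (d E M m β).1 x = 0 := by
  by_contra! hμ
  borelize E
  have : FiniteDimensional ℝ E := FiniteDimensional.of_finrank_pos (by omega)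
  have b : Basis (Fin (m + 1)) ℝ E := finBasisOfFinrankEq ℝ E hm
  obtain ⟨t, ρ, hρ⟩ := exists_smoothPartitionOfUnity_isSubordinate_chartAt (E := E) (M := M)
  have he : ∀ x : t, chartAt E x.1 ∈ IsManifold.maximalAtlas 𝓘(ℝ, E) ∞ M := fun x =>
    IsManifold.chart_mem_maximalAtlas _
  exact (formIntegral_self_pos Measure.addHaar he hρ b hμ).ne'
    (formIntegral_d_eq_zero Measure.addHaar he hρ b hμ β)

end Stokes

section Cohomology

theorem linearIndependent_of_forall_sphere {ι W : Type*} [Fintype ι] [AddCommGroup W] [Module ℝ W]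
    {v : ι → W} (h : ∀ c ∈ Metric.sphere (0 : EuclideanSpace ℝ ι) 1, ∑ i, c i • v i ≠ 0) :
    LinearIndependent ℝ v := by
  refine Fintype.linearIndependent_iff.2 fun c hc => ?_
  by_contra! hne
  have hc' : WithLp.toLp 2 c ≠ 0 := fun h0 =>
    hne.elim fun i hi => hi (congrArg (fun w : EuclideanSpace ℝ ι => w i) h0)
  refine h (‖WithLp.toLp 2 c‖⁻¹ • WithLp.toLp 2 c) ?_ ?_
  · rw [mem_sphere_zero_iff_norm, norm_smul, norm_inv, norm_norm,
      inv_mul_cancel₀ (norm_ne_zero_iff.2 hc')]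
  · simp only [PiLp.smul_apply, smul_assoc, ← Finset.smul_sum, hc, smul_zero]

variable {E : Type*} [NormedAddCommGroup E] [NormedSpace ℝ E]
  {M : Type*} [TopologicalSpace M] [ChartedSpace E M] [IsManifold 𝓘(ℝ, E) ∞ M] {k : ℕ}

theorem deRhamClass_eq_zero_iff {α : DiffForm E M k} (hα : α ∈ closedForms E M k) :
    deRhamClass α hα = 0 ↔ α ∈ exactForms E M k :=
  Submodule.Quotient.mk_eq_zero _

theorem sum_smul_deRhamClass {ι : Type*} [Fintype ι] {α : ι → DiffForm E M k}
    (hα : ∀ i, α i ∈ closedForms E M k) (c : ι → ℝ) :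
    ∑ i, c i • deRhamClass (α i) (hα i) =
      deRhamClass (∑ i, c i • α i) (Submodule.sum_smul_mem _ c fun i _ => hα i) := by
  refine (map_sum (Submodule.mkQ _) (fun i => c i • (⟨α i, hα i⟩ : closedForms E M k)) _).symm.trans
    (congrArg (Submodule.mkQ _) (Subtype.ext ?_))
  exact AddSubmonoidClass.coe_finsetSum _ _

theorem linearIndependent_deRhamClass {ι : Type*} [Fintype ι] {α : ι → DiffForm E M k}
    (hα : ∀ i, α i ∈ closedForms E M k)
    (h : ∀ c ∈ Metric.sphere (0 : EuclideanSpace ℝ ι) 1, ∑ i, c i • α i ∉ exactForms E M k) :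
    LinearIndependent ℝ fun i => deRhamClass (α i) (hα i) :=
  linearIndependent_of_forall_sphere fun c hc => by
    rw [sum_smul_deRhamClass hα, Ne, deRhamClass_eq_zero_iff]
    exact h c hc

theorem natCast_le_betti {m : ℕ} {v : Fin m → DeRham E M k} (hv : LinearIndependent ℝ v) :
    (m : Cardinal) ≤ betti E M k := by
  simpa only [betti, Cardinal.mk_fin, Cardinal.lift_natCast, Cardinal.lift_uzero,
    Cardinal.nat_le_lift_iff] using hv.cardinal_lift_le_rank

end Cohomology

section Cosymplectic

theorem zero_wedge {V : Type*} [AddCommGroup V] [Module ℝ V] {k l : ℕ} (b : V [⋀^Fin l]→ₗ[ℝ] ℝ) :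
    wedge (0 : V [⋀^Fin k]→ₗ[ℝ] ℝ) b = 0 :=
  (wedgeLin k l).map_zero₂ b

variable {n : ℕ} {M : Type*} [TopologicalSpace M]
  [ChartedSpace (EuclideanSpace ℝ (Fin (2 * n + 1))) M]

namespace IsAlmostCosymplectic

variable {η : DiffForm (EuclideanSpace ℝ (Fin (2 * n + 1))) M 1}
  {Ω : DiffForm (EuclideanSpace ℝ (Fin (2 * n + 1))) M 2}

theorem eta_apply_ne_zero (h : IsAlmostCosymplectic η Ω) (x : M) : η.1 x ≠ 0 := fun hx =>
  h x <| by
    rw [hx]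
    exact zero_wedge _

theorem wedgeForm_powForm_apply_ne_zero (h : IsAlmostCosymplectic η Ω) (x : M) :
    (wedgeForm η (powForm Ω n)).1 x ≠ 0 := fun hx =>
  h x <| by
    rw [← toAlternatingMap_powForm_apply]
    exact congrArg ContinuousAlternatingMap.toAlternatingMap hx

variable [IsManifold (𝓡 (2 * n + 1)) ∞ M] [T2Space M] [CompactSpace M] [Nonempty M]

theorem eta_notMem_exactForms (h : IsAlmostCosymplectic η Ω) (hΩ : Ω ∈ closedForms _ M 2) :
    η ∉ exactForms _ M 1 := by
  rintro ⟨f, rfl⟩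
  obtain ⟨x, hx⟩ := exists_d_apply_eq_zero (by rw [finrank_euclideanSpace_fin, Nat.zero_add])
    (wedgeForm f (powForm Ω n))
  refine h.wedgeForm_powForm_apply_ne_zero x (ContinuousAlternatingMap.ext fun v => ?_)
  have hcast := d_wedgeForm_apply_of_closed_right f (powForm_mem_closedForms hΩ n) x
    (v ∘ Fin.cast (Nat.add_right_comm 0 (2 * n) 1))
  rw [hx] at hcast
  exact hcast.symm

theorem omega_notMem_exactForms (h : IsAlmostCosymplectic η Ω) (hn : 0 < n)
    (hη : η ∈ closedForms _ M 1) (hΩ : Ω ∈ closedForms _ M 2) : Ω ∉ exactForms _ M 2 := by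
  rintro ⟨α, rfl⟩
  obtain ⟨m, rfl⟩ := Nat.exists_eq_succ_of_ne_zero hn.ne'
  set Ω := d (EuclideanSpace ℝ (Fin (2 * (m + 1) + 1))) M 1 α
  have hpow : d _ M _ (wedgeForm (powForm Ω m) α) = wedgeForm (powForm Ω m) Ω :=
    Subtype.ext <| funext fun x => ContinuousAlternatingMap.ext fun v => by
      rw [d_wedgeForm_apply_of_closed_left (powForm_mem_closedForms hΩ m), pow_mul, neg_one_sq,
        one_pow, one_mul]
  obtain ⟨x, hx⟩ := exists_d_apply_eq_zero (m := 1 + (2 * m + 1))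
    (by rw [finrank_euclideanSpace_fin]; lia) (wedgeForm η (wedgeForm (powForm Ω m) α))
  refine h.wedgeForm_powForm_apply_ne_zero x (ContinuousAlternatingMap.ext fun v => ?_)
  have hv := d_wedgeForm_apply_of_closed_left hη (wedgeForm (powForm Ω m) α) x v
  rw [hx, hpow, pow_one, neg_one_mul] at hv
  exact neg_eq_zero.1 hv.symm

end IsAlmostCosymplectic

theorem card_le_finrank_of_linearIndependent_cotangent {E : Type*} [NormedAddCommGroup E]
    [NormedSpace ℝ E] [FiniteDimensional ℝ E] {ι : Type*} [Fintype ι] {a : ι → E [⋀^Fin 1]→L[ℝ] ℝ}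
    (ha : LinearIndependent ℝ a) : Fintype.card ι ≤ Module.finrank ℝ E := by
  let e : Module.Dual ℝ E ≃ₗ[ℝ] E [⋀^Fin 1]→L[ℝ] ℝ := LinearMap.toContinuousLinearMap.trans
    (ContinuousAlternatingMap.ofSubsingletonLIE (0 : Fin 1)).toLinearEquiv
  exact (ha.map' e.symm.toLinearMap e.symm.ker).fintype_card_le_finrank.trans_eq
    Subspace.dual_finrank_eq

theorem IsAlmostCosymplecticSphere.le_two_mul [Nonempty M] {p : ℕ}
    {η : Fin (p + 1) → DiffForm (EuclideanSpace ℝ (Fin (2 * n + 1))) M 1}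
    {Ω : Fin (p + 1) → DiffForm (EuclideanSpace ℝ (Fin (2 * n + 1))) M 2}
    (h : IsAlmostCosymplecticSphere η Ω) : p ≤ 2 * n := by
  obtain ⟨x⟩ := ‹Nonempty M›
  let a : Fin (p + 1) → EuclideanSpace ℝ (Fin (2 * n + 1)) [⋀^Fin 1]→L[ℝ] ℝ := fun i => (η i).1 x
  have ha : LinearIndependent ℝ a := linearIndependent_of_forall_sphere fun c hc hx =>
    (h.sphere c hc).eta_apply_ne_zero x <| by
      rw [Submodule.coe_sum, Finset.sum_apply]
      exact hx
  have hcard := card_le_finrank_of_linearIndependent_cotangent ha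
  rw [Fintype.card_fin] at hcard
  exact Nat.le_of_succ_le_succ (hcard.trans_eq finrank_euclideanSpace_fin)

namespace IsCosymplecticSphere

variable [IsManifold (𝓡 (2 * n + 1)) ∞ M] [T2Space M] [CompactSpace M] [Nonempty M] {p : ℕ}
  {η : Fin (p + 1) → DiffForm (EuclideanSpace ℝ (Fin (2 * n + 1))) M 1}
  {Ω : Fin (p + 1) → DiffForm (EuclideanSpace ℝ (Fin (2 * n + 1))) M 2}

theorem linearIndependent_deRhamClass_eta (h : IsCosymplecticSphere η Ω) :
    LinearIndependent ℝ fun i => deRhamClass (η i) (h.closed_eta i) :=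
  linearIndependent_deRhamClass h.closed_eta fun c hc =>
    (h.sphere c hc).eta_notMem_exactForms (Submodule.sum_smul_mem _ c fun i _ => h.closed_omega i)

theorem linearIndependent_deRhamClass_omega (h : IsCosymplecticSphere η Ω) (hn : 0 < n) :
    LinearIndependent ℝ fun i => deRhamClass (Ω i) (h.closed_omega i) :=
  linearIndependent_deRhamClass h.closed_omega fun c hc =>
    (h.sphere c hc).omega_notMem_exactForms hn
      (Submodule.sum_smul_mem _ c fun i _ => h.closed_eta i)
      (Submodule.sum_smul_mem _ c fun i _ => h.closed_omega i)

end IsCosymplecticSphere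

end Cosymplectic

end CosymplecticSphere

end

theorem mainTheorem4 {n p : ℕ} {M : Type*} [TopologicalSpace M]
    [ChartedSpace (EuclideanSpace ℝ (Fin (2 * n + 1))) M] [IsManifold (𝓡 (2 * n + 1)) ∞ M]
    [T2Space M] [CompactSpace M] [Nonempty M]
    (η : Fin (p + 1) → CosymplecticSphere.DiffForm (EuclideanSpace ℝ (Fin (2 * n + 1))) M 1)
    (Ω : Fin (p + 1) → CosymplecticSphere.DiffForm (EuclideanSpace ℝ (Fin (2 * n + 1))) M 2)
    (h : CosymplecticSphere.IsCosymplecticSphere η Ω) :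
    ((∀ i, CosymplecticSphere.deRhamClass (η i) (h.closed_eta i) ≠ 0) ∧
      LinearIndependent ℝ
        (fun i => CosymplecticSphere.deRhamClass (η i) (h.closed_eta i)) ∧
      ((p + 1 : ℕ) : Cardinal) ≤
        CosymplecticSphere.betti (EuclideanSpace ℝ (Fin (2 * n + 1))) M 1) ∧
    (0 < n ∨ 0 < p →
      (∀ i, CosymplecticSphere.deRhamClass (Ω i) (h.closed_omega i) ≠ 0) ∧
      LinearIndependent ℝ
        (fun i => CosymplecticSphere.deRhamClass (Ω i) (h.closed_omega i)) ∧
      ((p + 1 : ℕ) : Cardinal) ≤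
        CosymplecticSphere.betti (EuclideanSpace ℝ (Fin (2 * n + 1))) M 2) := by
  have hη := h.linearIndependent_deRhamClass_eta
  refine ⟨⟨hη.ne_zero, hη, CosymplecticSphere.natCast_le_betti hη⟩, fun hnp => ?_⟩
  have hn : 0 < n := hnp.elim id fun hp => by
    have := h.le_two_mul
    lia
  have hΩ := h.linearIndependent_deRhamClass_omega hn
  exact ⟨hΩ.ne_zero, hΩ, CosymplecticSphere.natCast_le_betti hΩ⟩
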